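/- Let $(\Omega,\mathcal F,\mathbb P)$ be a probability space and let $\{X_i\}_{i\in\mathbb N}$ be a sequence of real random variables on it such that every finite subfamily is jointly Gaussian, $\mathbb E[X_i]=0$ for all $i$, and for every $N$ the covariance matrix $\Sigma_N:=\mathbb E[\mathbf X_N\mathbf X_N^{T}]$ of $\mathbf X_N:=(X_1,\dots,X_N)^T$ is positive-definite. Let $\mathcal F_\infty:=\sigma(\{X_i\}_{i\in\mathbb N})$. For a multi-index $\mathbf j\in\mathbb N_0^N$ with $|\mathbf j|:=j_1+\dots+j_N$ put $$H_{\mathbf j}(\mathbf x;\Sigma_N):=\frac{(-1)^{|\mathbf j|}}{\phi(\mathbf x;\Sigma_N)}\,\frac{\partial^{|\mathbf j|}\phi(\mathbf x;\Sigma_N)}{\partial x_1^{j_1}\cdots\partial x_N^{j_N}},\qquad \Psi^{(N)}_{\mathbf j}:=\frac{H_{\mathbf j}(\mathbf X_N;\Sigma_N)}{\sqrt{\mathbb E[H_{\mathbf j}(\mathbf X_N;\Sigma_N)^2]}},$$ where $\phi(\mathbf x;\Sigma):=(2\pi)^{-N/2}(\det\Sigma)^{-1/2}\exp(-\tfrac12\mathbf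 x^T\Sigma^{-1}\mathbf x)$. Let $y\in L^2(\Omega,\mathcal F_\infty,\mathbb P)$. Then for every $N$ there is exactly one family of coefficients $(C^{(N)}_{\mathbf j})_{\mathbf j\in\mathbb N_0^N}$ of real numbers with $$\sum_{\mathbf k\in\mathbb N_0^N,\ |\mathbf k|=|\mathbf j|}C^{(N)}_{\mathbf k}\,\mathbb E\big[\Psi^{(N)}_{\mathbf j}\Psi^{(N)}_{\mathbf k}\big]=\mathbb E\big[y\,\Psi^{(N)}_{\mathbf j}\big]\qquad\text{for all }\mathbf j\in\mathbb N_0^N,$$ and the generalized polynomial chaos expansion (PCE) of $y$, that is, the family of its truncations $$y_{N,m}:=\sum_{\mathbf j\in\mathbb N_0^N,\ |\mathbf j|\le m}C^{(N)}_{\mathbf j}\,\Psi^{(N)}_{\mathbf j},$$ converges to $y$ in mean square, in probability and in distribution as $N\to\infty$ and $m\to\infty$ jointly (independently of each other). The same holds for both iterated limits: for each $N$ the expansion in $X_1,\dots,X_N$ converges as $m\to\infty$ to some $S_N\in L^2(\Omega,\mathcal F,\mathbb P)$, and $S_N\to y$ as $N\to\infty$; for each degree $m$ the truncations $y_{N,m}$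 converge as $N\to\infty$ to some $T_m\in L^2(\Omega,\mathcal F,\mathbb P)$, and $T_m\to y$ as $m\to\infty$; all these convergences hold in mean square, in probability and in distribution. -/

import Mathlib

open MeasureTheory ProbabilityTheory Filter Topology
open scoped Matrix

noncomputable section

namespace GPCE

/-- The centred Gaussian density on `ℝ^N` with covariance matrix `S`. -/
def gaussDensity {N : ℕ} (S : Matrix (Fin N) (Fin N) ℝ) (x : Fin N → ℝ) : ℝ :=
  (2 * Real.pi) ^ (-(N : ℝ) / 2) * S.det ^ (-(1 : ℝ) / 2) *
    Real.exp (-(1 / 2) * (x ⬝ᵥ (S⁻¹ *ᵥ x)))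

/-- The partial derivative `∂f/∂x_i`. -/
def partialDeriv {N : ℕ} (i : Fin N) (f : (Fin N → ℝ) → ℝ) : (Fin N → ℝ) → ℝ :=
  fun x => lineDeriv ℝ f x (Pi.single i 1)

/-- The mixed partial derivative `∂^{j_1 + ⋯ + j_N} f / ∂x_1^{j_1} ⋯ ∂x_N^{j_N}`. -/
def mixedDeriv {N : ℕ} (j : Fin N → ℕ) (f : (Fin N → ℝ) → ℝ) : (Fin N → ℝ) → ℝ :=
  (List.finRange N).foldr (fun i g => (partialDeriv i)^[j i] g) f

/-- The multivariate Hermite orthogonal polynomial `H_j(x; S)`, by Rodrigues' formula. -/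
def hermitePoly {N : ℕ} (S : Matrix (Fin N) (Fin N) ℝ) (j : Fin N → ℕ) (x : Fin N → ℝ) : ℝ :=
  (-1) ^ (∑ i, j i) / gaussDensity S x * mixedDeriv j (gaussDensity S) x

section Inputs

variable {Ω : Type*} [MeasurableSpace Ω] (P : Measure Ω) (X : ℕ → Ω → ℝ)

/-- The random vector of the first `N` input variables. -/
def firstVars (N : ℕ) (ω : Ω) : Fin N → ℝ := fun i => X i ω

/-- The matrix `E[X Xᵀ]` of the first `N` input variables (their covariance matrix when they are
centred). -/
def covMatrix (N : ℕ) : Matrix (Fin N) (Fin N) ℝ :=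
  Matrix.of fun a b => ∫ ω, X a ω * X b ω ∂P

/-- The standardized Hermite polynomial in the first `N` input variables, as a random variable:
`Ψ_j(X; S) = H_j(X; S) / √(E[H_j(X; S)²])`, with `S` the covariance matrix of these variables. -/
def stdHermite (N : ℕ) (j : Fin N → ℕ) (ω : Ω) : ℝ :=
  hermitePoly (covMatrix P X N) j (firstVars X N ω) /
    √(∫ ω', hermitePoly (covMatrix P X N) j (firstVars X N ω') ^ 2 ∂P)

/-- `C` is a family of expansion coefficients of `Y` in the first `N` input variables: for every
multi-index `j`, `∑_{|k| = |j|} C_k E[Ψ_j Ψ_k] = E[Y Ψ_j]`. -/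
def IsCoeff (Y : Ω → ℝ) (N : ℕ) (C : (Fin N → ℕ) → ℝ) : Prop :=
  ∀ j : Fin N → ℕ,
    ∑ k ∈ Finset.piAntidiag Finset.univ (∑ i, j i),
        C k * ∫ ω, stdHermite P X N j ω * stdHermite P X N k ω ∂P =
      ∫ ω, Y ω * stdHermite P X N j ω ∂P

/-- The expansion with coefficients `C` in the first `N` input variables, truncated at total
degree `m`: `∑_{l ≤ m} ∑_{|j| = l} C_j Ψ_j`. -/
def truncPCE (N : ℕ) (C : (Fin N → ℕ) → ℝ) (m : ℕ) (ω : Ω) : ℝ :=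
  ∑ l ∈ Finset.range (m + 1), ∑ j ∈ Finset.piAntidiag Finset.univ l,
    C j * stdHermite P X N j ω

/-- Convergence in mean square, in probability and in distribution, along a filter. -/
structure ConvergesInAllModes [IsProbabilityMeasure P] {ι : Type*} (Z : ι → Ω → ℝ) (l : Filter ι)
    (Y : Ω → ℝ) : Prop where
  meanSquare : Tendsto (fun i => eLpNorm (Z i - Y) 2 P) l (𝓝 0)
  inProbability : TendstoInMeasure P Z l Y
  inDistribution : TendstoInDistribution Z l Y (fun _ => P) P

end Inputs

end GPCE

end

namespace GPCE

open MvPolynomial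
open scoped NNReal ENNReal

/-! ### Hermite polynomials as formal polynomials -/

section Algebra

variable {N : ℕ}

/-! The truncation `y_{N,m}` is the orthogonal projection of `y` onto the space of polynomials of
degree at most `m` in the first `N` inputs (`starProjection_polySpace`). These spaces increase in
`N` and in `m`, and `y` lies in the closure of their union (`toLp_mem_of_polySpace_le`). Projections
onto an increasing family of subspaces converge strongly to the projection onto the closure of the
union. This gives the joint limit and, with closures of partial unions as intermediate spaces, both
iterated limits. Mean-square convergence implies the other two modes.

Projection: by Rodrigues' formula `H_j` arises from `1` by raising operators `q ↦ (S⁻¹x)_i q - ∂_i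
q`. Gaussian integration by parts (`polyExpect_precisionForm_mul`) makes these adjoint to `∂_i`, so
`E[H_j x^k] = j! δ_{jk}` whenever `|k| ≤ |j|`. Hence Hermite polynomials of different degrees are
orthogonal, and all of them are independent, though those of equal degree need not be orthogonal.
The coefficient equations are then one invertible Gram system per degree.

Density: if `Z` is orthogonal to all polynomials, the power series of `exp(iL(X))` gives `E[Z
exp(iL(X))] = 0` for every linear form `L`. So `Z⁺P` and `Z⁻P` induce the same law of the input
sequence, and `Z = 0` when `Z` is a function of the inputs
(`ae_eq_zero_of_integral_mul_polynomial_eq_zero`). -/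

/-- The linear form `x ↦ (S⁻¹ x)_i`, as a polynomial. -/
noncomputable def precisionForm (S : Matrix (Fin N) (Fin N) ℝ) (i : Fin N) :
    MvPolynomial (Fin N) ℝ :=
  ∑ b, C (S⁻¹ i b) * X b

/-- The raising operator `q ↦ (S⁻¹ x)_i q - ∂_i q`. -/
noncomputable def hermiteRaise (S : Matrix (Fin N) (Fin N) ℝ) (i : Fin N)
    (q : MvPolynomial (Fin N) ℝ) : MvPolynomial (Fin N) ℝ :=
  precisionForm S i * q - pderiv i q

/-- The raising operators of the indices in `l`, with multiplicities `j`, applied to `1`. -/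
noncomputable def hermiteAux (S : Matrix (Fin N) (Fin N) ℝ) (j : Fin N → ℕ) (l : List (Fin N)) :
    MvPolynomial (Fin N) ℝ :=
  l.foldr (fun i g => (hermiteRaise S i)^[j i] g) 1

lemma eval_precisionForm (S : Matrix (Fin N) (Fin N) ℝ) (i : Fin N) (x : Fin N → ℝ) :
    eval x (precisionForm S i) = (S⁻¹ *ᵥ x) i := by
  simp [precisionForm, Matrix.mulVec, dotProduct]

lemma totalDegree_precisionForm_le (S : Matrix (Fin N) (Fin N) ℝ) (i : Fin N) :
    (precisionForm S i).totalDegree ≤ 1 := by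
  refine totalDegree_finsetSum_le fun b _ => (totalDegree_mul _ _).trans ?_
  simp

lemma totalDegree_pderiv_le {σ R : Type*} [CommSemiring R] (i : σ) (q : MvPolynomial σ R) :
    (pderiv i q).totalDegree ≤ q.totalDegree := by
  classical
  conv_lhs => rw [q.as_sum, map_sum]
  refine totalDegree_finsetSum_le fun v hv => ?_
  rw [pderiv_monomial]
  refine (totalDegree_monomial_le _ _).trans (le_trans ?_ (le_totalDegree hv))
  exact Finsupp.degree_mono tsub_le_self

lemma totalDegree_hermiteRaise_le (S : Matrix (Fin N) (Fin N) ℝ) (i : Fin N)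
    (q : MvPolynomial (Fin N) ℝ) :
    (hermiteRaise S i q).totalDegree ≤ q.totalDegree + 1 := by
  refine (totalDegree_sub _ _).trans (max_le ?_ ?_)
  · refine (totalDegree_mul _ _).trans ?_
    have := totalDegree_precisionForm_le S i
    omega
  · exact (totalDegree_pderiv_le i q).trans (Nat.le_succ _)

lemma totalDegree_iterate_hermiteRaise_le (S : Matrix (Fin N) (Fin N) ℝ) (i : Fin N) (n : ℕ)
    (q : MvPolynomial (Fin N) ℝ) :
    ((hermiteRaise S i)^[n] q).totalDegree ≤ q.totalDegree + n := by
  induction n with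
  | zero => simp
  | succ n ih =>
    rw [Function.iterate_succ_apply']
    have := totalDegree_hermiteRaise_le S i ((hermiteRaise S i)^[n] q)
    omega

lemma totalDegree_hermiteAux_le (S : Matrix (Fin N) (Fin N) ℝ) (j : Fin N → ℕ)
    (l : List (Fin N)) : (hermiteAux S j l).totalDegree ≤ (l.map j).sum := by
  induction l with
  | nil => simp [hermiteAux]
  | cons i l ih =>
    have := totalDegree_iterate_hermiteRaise_le S i (j i) (hermiteAux S j l)
    simp only [hermiteAux, List.foldr_cons, List.map_cons, List.sum_cons] at *
    omega

/-- Truncated subtraction in the exponent is harmless: the descending factorial vanishes once `n`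
exceeds `k i`. -/
lemma iterate_pderiv_monomial {σ : Type*} (i : σ) (n : ℕ) (k : σ →₀ ℕ) (a : ℝ) :
    (pderiv i)^[n] (monomial k a) =
      monomial (k - Finsupp.single i n) (a * (k i).descFactorial n) := by
  classical
  induction n with
  | zero => simp
  | succ n ih =>
    rw [Function.iterate_succ_apply', ih, pderiv_monomial, tsub_tsub, ← Finsupp.single_add]
    congr 1
    rw [Nat.descFactorial_succ]
    simp
    ring

/-! ### Raising operators as adjoints of partial derivatives. -/

section Adjoint

variable {S : Matrix (Fin N) (Fin N) ℝ} {E : MvPolynomial (Fin N) ℝ →ₗ[ℝ] ℝ}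

/-- Integration by parts applied to `q * p`, followed by the Leibniz rule: the term `∂_i q * p` is
exactly what the raising operator subtracts. -/
lemma apply_iterate_hermiteRaise_mul
    (hE : ∀ i p, E (precisionForm S i * p) = E (pderiv i p)) (i : Fin N) (n : ℕ)
    (q p : MvPolynomial (Fin N) ℝ) :
    E ((hermiteRaise S i)^[n] q * p) = E (q * (pderiv i)^[n] p) := by
  have h1 : ∀ q p, E (hermiteRaise S i q * p) = E (q * pderiv i p) := by
    intro q p
    have := hE i (q * p)
    rw [Derivation.leibniz] at this
    simp only [smul_eq_mul, map_add] at this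
    rw [hermiteRaise, sub_mul, map_sub, mul_assoc, this, mul_comm p]
    ring
  induction n generalizing p with
  | zero => rfl
  | succ n ih => rw [Function.iterate_succ_apply', h1, ih, ← Function.iterate_succ_apply]

/-- All derivatives move onto the monomial. Since `l` has no repetitions, removing the index `i`
leaves the exponents at the later indices unchanged, so the descending factorials are those of the
original `k`. -/
lemma apply_hermiteAux_mul_monomial
    (hE : ∀ i p, E (precisionForm S i * p) = E (pderiv i p)) (j : Fin N → ℕ)
    (l : List (Fin N)) (hl : l.Nodup) (k : Fin N →₀ ℕ) (a : ℝ) :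
    E (hermiteAux S j l * monomial k a) =
      E (monomial (k - (l.map fun i => Finsupp.single i (j i)).sum)
        (a * (l.map fun i => ((k i).descFactorial (j i) : ℝ)).prod)) := by
  induction l generalizing k a with
  | nil => simp [hermiteAux]
  | cons i l ih =>
    have hi := (List.nodup_cons.1 hl).1
    rw [hermiteAux, List.foldr_cons, apply_iterate_hermiteRaise_mul hE, iterate_pderiv_monomial]
    refine (ih (List.nodup_cons.1 hl).2 _ _).trans ?_
    rw [List.map_cons, List.sum_cons, List.map_cons, List.prod_cons, tsub_tsub, mul_assoc]
    have : l.map (fun i' => (((k - Finsupp.single i (j i)) i').descFactorial (j i') : ℝ)) =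
        l.map fun i' => ((k i').descFactorial (j i') : ℝ) := by
      refine List.map_congr_left fun b hb => ?_
      have : b ≠ i := fun h => hi (h ▸ hb)
      simp [this.symm]
    rw [this]

/-- Pairing of a Hermite polynomial with a monomial of at most the same degree. -/
lemma apply_hermite_mul_monomial (hE1 : E 1 = 1)
    (hE : ∀ i p, E (precisionForm S i * p) = E (pderiv i p)) (j : Fin N → ℕ)
    (k : Fin N →₀ ℕ) (hk : ∑ i, k i ≤ ∑ i, j i) :
    E (hermiteAux S j (List.finRange N) * monomial k 1) =
      if ⇑k = j then ∏ i, ((j i).factorial : ℝ) else 0 := by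
  rw [apply_hermiteAux_mul_monomial hE _ _ (List.nodup_finRange N)]
  rw [← Fin.prod_univ_def, ← Fin.sum_univ_def, one_mul]
  split_ifs with h
  · have h0 : k - ∑ i, Finsupp.single i (j i) = 0 := by
      ext b
      simp [Finsupp.single_apply, h]
    rw [h0, h]
    simp only [Nat.descFactorial_self]
    have : monomial (0 : Fin N →₀ ℕ) (∏ i, ((j i).factorial : ℝ)) =
      (∏ i, ((j i).factorial : ℝ)) • 1 := by
      rw [← MvPolynomial.C_apply, MvPolynomial.smul_eq_C_mul, mul_one]
    rw [this, map_smul, hE1, smul_eq_mul, mul_one]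
  -- Otherwise `j ≤ k` in every coordinate, and `|k| ≤ |j|` would force `k = j`. At such an `i` the
  -- descending factorial is zero.
  · obtain ⟨i, hi⟩ : ∃ i, k i < j i := by
      by_contra! hc
      refine h (funext fun i => ?_)
      have hs : ∑ i, j i = ∑ i, k i := le_antisymm (Finset.sum_le_sum fun i _ => hc i) hk
      exact ((Finset.sum_eq_sum_iff_of_le fun i _ => hc i).1 hs i (Finset.mem_univ i)).symm
    rw [Finset.prod_eq_zero (Finset.mem_univ i)]
    · simp
    · simp [Nat.descFactorial_eq_zero_iff_lt.2 hi]

end Adjoint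

/-! ### Comparison with Rodrigues' formula -/

lemma hasDerivAt_eval_line (x : Fin N → ℝ) (i : Fin N) (q : MvPolynomial (Fin N) ℝ) (t : ℝ) :
    HasDerivAt (fun t : ℝ => eval (x + t • Pi.single i 1) q)
      (eval (x + t • Pi.single i 1) (pderiv i q)) t := by
  induction q using MvPolynomial.induction_on with
  | C a => simpa using hasDerivAt_const t a
  | add p q hp hq => simpa using hp.fun_add hq
  | mul_X p b hp =>
    have hX : HasDerivAt (fun t : ℝ => x b + t * (Pi.single i 1 : Fin N → ℝ) b)
        ((Pi.single i 1 : Fin N → ℝ) b) t := by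
      simpa using ((hasDerivAt_id t).mul_const ((Pi.single i 1 : Fin N → ℝ) b)).const_add (x b)
    convert! hp.mul hX using 1
    · ext t; simp
    · rw [Derivation.leibniz, pderiv_X]
      simp only [smul_eq_mul, map_add, map_mul, eval_X, Pi.add_apply, Pi.smul_apply]
      by_cases h : i = b
      · subst h; simp; ring
      · simp [Ne.symm h]; ring

/-- The quadratic form `x ↦ xᵀ S⁻¹ x`, as a polynomial. -/
noncomputable def precisionQuad (S : Matrix (Fin N) (Fin N) ℝ) : MvPolynomial (Fin N) ℝ :=
  ∑ a, X a * precisionForm S a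

lemma eval_precisionQuad (S : Matrix (Fin N) (Fin N) ℝ) (x : Fin N → ℝ) :
    eval x (precisionQuad S) = x ⬝ᵥ (S⁻¹ *ᵥ x) := by
  simp [precisionQuad, dotProduct, eval_precisionForm]

lemma pderiv_precisionQuad {S : Matrix (Fin N) (Fin N) ℝ} (hS : S⁻¹.IsSymm) (i : Fin N) :
    pderiv i (precisionQuad S) = 2 * precisionForm S i := by
  have h : ∀ a, pderiv i (precisionForm S a) = C (S⁻¹ a i) := by
    intro a
    simp [precisionForm, pderiv_X, Pi.single_apply]
  simp only [precisionQuad, map_sum, Derivation.leibniz, h, smul_eq_mul, Finset.sum_add_distrib]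
  have h1 : ∑ a, (X a : MvPolynomial (Fin N) ℝ) * C (S⁻¹ a i) = precisionForm S i := by
    simp only [precisionForm]
    exact Finset.sum_congr rfl fun a _ => by rw [hS.apply, mul_comm]
  rw [h1]
  simp [pderiv_X, Pi.single_apply, two_mul]

/-- The logarithmic derivative of the density is `-(S⁻¹x)_i`, by symmetry of `S⁻¹`. The scalar `c`
carries the signs accumulated under iteration. -/
lemma partialDeriv_eval_mul_gaussDensity {S : Matrix (Fin N) (Fin N) ℝ} (hS : S⁻¹.IsSymm)
    (i : Fin N) (q : MvPolynomial (Fin N) ℝ) (c : ℝ) :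
    partialDeriv i (fun x => c * eval x q * gaussDensity S x) =
      fun x => -c * eval x (hermiteRaise S i q) * gaussDensity S x := by
  ext x
  have hq := hasDerivAt_eval_line x i q 0
  have hQ := (((hasDerivAt_eval_line x i (precisionQuad S) 0).const_mul (-(1 / 2))).exp).const_mul
    ((2 * Real.pi) ^ (-(N : ℝ) / 2) * S.det ^ (-(1 : ℝ) / 2))
  have := (hq.const_mul c).mul hQ
  simp only [pderiv_precisionQuad hS, zero_smul, add_zero] at this
  have h2 := this.deriv
  rw [partialDeriv, lineDeriv]
  simp only [gaussDensity, ← eval_precisionQuad]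
  refine Eq.trans h2 ?_
  simp [hermiteRaise]
  ring

lemma mixedDeriv_gaussDensity {S : Matrix (Fin N) (Fin N) ℝ} (hS : S⁻¹.IsSymm)
    (j : Fin N → ℕ) (l : List (Fin N)) :
    l.foldr (fun i g => (partialDeriv i)^[j i] g) (gaussDensity S) =
      fun x => (-1) ^ (l.map j).sum * eval x (hermiteAux S j l) * gaussDensity S x := by
  induction l with
  | nil => simp [hermiteAux]
  | cons i l ih =>
    have key : ∀ n (c : ℝ) q, (partialDeriv i)^[n] (fun x => c * eval x q * gaussDensity S x) =
        fun x => ((-1) ^ n * c) * eval x ((hermiteRaise S i)^[n] q) * gaussDensity S x := by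
      intro n
      induction n with
      | zero => simp
      | succ n ih =>
        intro c q
        rw [Function.iterate_succ_apply', ih, partialDeriv_eval_mul_gaussDensity hS,
          Function.iterate_succ_apply', pow_succ]
        ext x; ring
    rw [List.foldr_cons, ih, key]
    simp only [hermiteAux, List.foldr_cons, List.map_cons, List.sum_cons, pow_add]

lemma gaussDensity_pos {S : Matrix (Fin N) (Fin N) ℝ} (hS : S.PosDef) (x : Fin N → ℝ) :
    0 < gaussDensity S x := by
  have := hS.det_pos
  unfold gaussDensity
  positivity

lemma hermitePoly_eq_eval {S : Matrix (Fin N) (Fin N) ℝ} (hS : S.PosDef) (j : Fin N → ℕ)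
    (x : Fin N → ℝ) :
    hermitePoly S j x = eval x (hermiteAux S j (List.finRange N)) := by
  have hsymm : S⁻¹.IsSymm := by
    have := hS.inv.isHermitian
    rwa [Matrix.IsHermitian, Matrix.conjTranspose_eq_transpose_of_trivial] at this
  rw [hermitePoly, mixedDeriv, mixedDeriv_gaussDensity hsymm, ← Fin.sum_univ_def]
  have h1 : ((-1 : ℝ) ^ ∑ i, j i) * (-1) ^ ∑ i, j i = 1 := by
    rw [← mul_pow]; simp
  have h2 := (gaussDensity_pos hS x).ne'
  rw [div_mul_eq_mul_div, div_eq_iff h2]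
  linear_combination (eval x (hermiteAux S j (List.finRange N)) * gaussDensity S x) * h1

end Algebra

/-! ### Gaussian integration by parts -/

lemma hasDerivAt_gaussianPDFReal (v : ℝ≥0) (x : ℝ) :
    HasDerivAt (gaussianPDFReal 0 v) (-(x / v) * gaussianPDFReal 0 v x) x := by
  have h : HasDerivAt (fun x : ℝ => -(x - 0) ^ 2 / (2 * v)) (-(x / v)) x := by
    have := (((hasDerivAt_id x).sub_const 0).fun_pow 2).fun_neg.div_const (2 * (v : ℝ))
    convert! this using 1
    simp
    ring
  have := h.exp.const_mul (√(2 * Real.pi * v))⁻¹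
  convert! this using 1
  simp only [gaussianPDFReal]
  ring

/-- One-dimensional Stein identity: integrate by parts against the density, whose derivative is
`-(x/v)` times itself. The integrability assumptions remove the boundary terms. -/
lemma integral_mul_gaussianReal {v : ℝ≥0} (hv : v ≠ 0) {f f' : ℝ → ℝ}
    (hf : ∀ x, HasDerivAt f (f' x) x) (hfi : Integrable f (gaussianReal 0 v))
    (hxf : Integrable (fun x => x * f x) (gaussianReal 0 v))
    (hf' : Integrable f' (gaussianReal 0 v)) :
    ∫ x, x * f x ∂gaussianReal 0 v = v * ∫ x, f' x ∂gaussianReal 0 v := by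
  have key : ∀ g : ℝ → ℝ, Integrable g (gaussianReal 0 v) →
      Integrable (fun x => gaussianPDFReal 0 v x * g x) := by
    intro g hg
    rw [gaussianReal_of_var_ne_zero _ hv, integrable_withDensity_iff_integrable_smul'
      (measurable_gaussianPDF 0 v) (ae_of_all _ fun _ => gaussianPDF_lt_top)] at hg
    simpa [toReal_gaussianPDF] using hg
  have hv' : (v : ℝ) ≠ 0 := by exact_mod_cast hv
  have hmul : ∀ x, f x * (-(x / v) * gaussianPDFReal 0 v x) =
      -(v : ℝ)⁻¹ * (gaussianPDFReal 0 v x * (x * f x)) := fun x => by ring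
  have := integral_mul_deriv_eq_deriv_mul_of_integrable (fun x _ => hf x)
    (fun x _ => hasDerivAt_gaussianPDFReal v x)
    (((key _ hxf).const_mul (-(v : ℝ)⁻¹)).congr (ae_of_all _ fun x => (hmul x).symm))
    ((key _ hf').congr (ae_of_all _ fun x => mul_comm _ _))
    ((key _ hfi).congr (ae_of_all _ fun x => mul_comm _ _))
  simp only [hmul, integral_const_mul] at this
  rw [integral_gaussianReal_eq_integral_smul hv, integral_gaussianReal_eq_integral_smul hv]
  simp only [smul_eq_mul]
  simp only [mul_comm (f' _)] at this
  linear_combination (-(v : ℝ)) * this + (∫ x, gaussianPDFReal 0 v x * (x * f x)) *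
    (-mul_inv_cancel₀ hv')

/-! ### Polynomial moments of the inputs and the multivariate Stein identity. -/

section Inputs

variable {Ω : Type*} [MeasurableSpace Ω] {P : Measure Ω} {X : ℕ → Ω → ℝ}

lemma hasGaussianLaw_firstVars (hXG : IsGaussianProcess X P) (N : ℕ) :
    HasGaussianLaw (firstVars X N) P :=
  (hXG.hasGaussianLaw (Finset.range N)).map_fun
    (ContinuousLinearMap.pi fun i : Fin N =>
      ContinuousLinearMap.proj (⟨i, Finset.mem_range.2 i.2⟩ : Finset.range N))

/-- Gaussian variables have all moments. The exponent is generalized in the induction because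
multiplying by a variable uses Hölder's inequality with `2p` and `2p`. -/
lemma memLp_eval_firstVars (hXG : IsGaussianProcess X P) {N : ℕ}
    (q : MvPolynomial (Fin N) ℝ) (p : ℝ≥0∞) (hp : p ≠ ∞) :
    MemLp (fun ω => eval (firstVars X N ω) q) p P := by
  have := hXG.isProbabilityMeasure
  induction q using MvPolynomial.induction_on generalizing p with
  | C a => simpa using memLp_const a
  | add q r hq hr => simpa using! (hq p hp).add (hr p hp)
  | mul_X q b hq =>
    have h2 : (2 * p) ≠ ∞ := ENNReal.mul_ne_top (by simp) hp
    have : ENNReal.HolderTriple (2 * p) (2 * p) p := by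
      refine ⟨?_⟩
      rw [ENNReal.mul_inv (by simp) (by simp), ← two_mul, ← mul_assoc,
        ENNReal.mul_inv_cancel (by simp) (by simp), one_mul]
    have hX : MemLp (fun ω => firstVars X N ω b) (2 * p) P := (hXG.hasGaussianLaw_eval b).memLp h2
    simpa using! hX.mul' (hq _ h2)

lemma integrable_eval_firstVars (hXG : IsGaussianProcess X P) {N : ℕ}
    (q : MvPolynomial (Fin N) ℝ) : Integrable (fun ω => eval (firstVars X N ω) q) P :=
  memLp_one_iff_integrable.1 (memLp_eval_firstVars hXG q 1 (by simp))

/-- Expectation of a polynomial in the first `N` inputs, as a linear functional. -/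
noncomputable def polyExpect (hXG : IsGaussianProcess X P) (N : ℕ) :
    MvPolynomial (Fin N) ℝ →ₗ[ℝ] ℝ where
  toFun q := ∫ ω, eval (firstVars X N ω) q ∂P
  map_add' q r := by
    simp only [map_add]
    exact integral_add (integrable_eval_firstVars hXG q) (integrable_eval_firstVars hXG r)
  map_smul' c q := by
    simp only [smul_eval, RingHom.id_apply, smul_eq_mul, integral_const_mul]

lemma polyExpect_apply (hXG : IsGaussianProcess X P) {N : ℕ} (q : MvPolynomial (Fin N) ℝ) :
    polyExpect hXG N q = ∫ ω, eval (firstVars X N ω) q ∂P := rfl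

lemma polyExpect_one (hXG : IsGaussianProcess X P) (N : ℕ) : polyExpect hXG N 1 = 1 := by
  have := hXG.isProbabilityMeasure
  simp [polyExpect_apply]

lemma polyExpect_C_mul (hXG : IsGaussianProcess X P) {N : ℕ} (c : ℝ)
    (q : MvPolynomial (Fin N) ℝ) : polyExpect hXG N (C c * q) = c * polyExpect hXG N q := by
  rw [← smul_eq_C_mul, map_smul, smul_eq_mul]

section Stein

variable (hXG : IsGaussianProcess X P) {N : ℕ}

lemma polyExpect_precisionForm_mul_X (hpd : (covMatrix P X N).PosDef) (i b : Fin N) :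
    polyExpect hXG N (precisionForm (covMatrix P X N) i * MvPolynomial.X b) =
      (1 : Matrix (Fin N) (Fin N) ℝ) i b := by
  have hdet : IsUnit (covMatrix P X N).det := hpd.det_pos.ne'.isUnit
  rw [← Matrix.nonsing_inv_mul _ hdet, Matrix.mul_apply, precisionForm, Finset.sum_mul, map_sum]
  refine Finset.sum_congr rfl fun a _ => ?_
  rw [mul_assoc, polyExpect_C_mul, polyExpect_apply]
  simp [covMatrix, firstVars]

lemma polyExpect_precisionForm_mul_self (hpd : (covMatrix P X N).PosDef) (i : Fin N) :
    polyExpect hXG N (precisionForm (covMatrix P X N) i * precisionForm (covMatrix P X N) i) =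
      (covMatrix P X N)⁻¹ i i := by
  conv_lhs => enter [2, 2]; rw [precisionForm]
  simp only [Finset.mul_sum, map_sum, mul_left_comm _ (C _), polyExpect_C_mul,
    polyExpect_precisionForm_mul_X hXG hpd, Matrix.one_apply]
  simp

lemma polyExpect_precisionForm (hX0 : ∀ i, ∫ ω, X i ω ∂P = 0) (i : Fin N) :
    polyExpect hXG N (precisionForm (covMatrix P X N) i) = 0 := by
  have h : ∀ b : Fin N, polyExpect hXG N (MvPolynomial.X b) = 0 := fun b => by
    simpa [polyExpect_apply, firstVars] using hX0 b
  simp [precisionForm, polyExpect_C_mul, h]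

/-- Gaussian integration by parts: `E[(S⁻¹ X)_i p(X)] = E[∂_i p(X)]`. -/
lemma polyExpect_precisionForm_mul (hX0 : ∀ i, ∫ ω, X i ω ∂P = 0)
    (hpd : (covMatrix P X N).PosDef) (i : Fin N) (p : MvPolynomial (Fin N) ℝ) :
    polyExpect hXG N (precisionForm (covMatrix P X N) i * p) =
      polyExpect hXG N (pderiv i p) := by
  have := hXG.isProbabilityMeasure
  set L := precisionForm (covMatrix P X N) i with hL
  set s : ℝ := (covMatrix P X N)⁻¹ i i with hs
  have hs0 : 0 < s := hpd.inv.diag_pos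
  set e : Fin N → ℝ := Pi.single i 1 with he
  -- With `U = (S⁻¹X)_i`, `Cov(X_j, U) = δ_{ij}` and `Var U = s`, so `W = X - (U/s) e` is the
  -- residual of regressing `X` on `U`. It is uncorrelated with `U`, hence independent by joint
  -- Gaussianity, and given `W` the vector `X` moves only along the `i`-th axis.
  let U : Ω → ℝ := fun ω => eval (firstVars X N ω) L
  let w : Fin N → MvPolynomial (Fin N) ℝ := fun j => MvPolynomial.X j - C (e j / s) * L
  let W : Fin N → Ω → ℝ := fun j ω => eval (firstVars X N ω) (w j)
  have hXUW : ∀ ω, (fun j => W j ω) + (U ω / s) • e = firstVars X N ω := by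
    intro ω; ext j; simp [W, U, w]; ring
  -- The independence criterion concerns two families, so `U` is indexed by `Unit`.
  have hlaw : HasGaussianLaw (fun ω => (fun j : Fin N => W j ω, fun _ : Unit => U ω)) P := by
    let A : (Fin N → ℝ) →ₗ[ℝ] (Fin N → ℝ) × (Unit → ℝ) :=
      { toFun := fun x => (fun j => x j - e j / s * ((covMatrix P X N)⁻¹ *ᵥ x) i,
          fun _ => ((covMatrix P X N)⁻¹ *ᵥ x) i)
        map_add' := fun x y => by
          ext <;> simp [Matrix.mulVec_add]; ring
        map_smul' := fun c x => by
          ext <;> simp [Matrix.mulVec_smul]; ring }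
    have := (hasGaussianLaw_firstVars hXG N).map_fun (LinearMap.toContinuousLinearMap A)
    convert! this using 2 with ω
    simp [A, W, U, w, hL, eval_precisionForm]
  have hmU : MemLp U 2 P := memLp_eval_firstVars hXG L 2 (by simp)
  have hmW : ∀ j, MemLp (W j) 2 P := fun j => memLp_eval_firstVars hXG _ 2 (by simp)
  have hU0 : P[U] = 0 := polyExpect_precisionForm hXG hX0 i
  have hcov : ∀ (j : Fin N) (_ : Unit), cov[W j, U; P] = 0 := by
    intro j _
    rw [covariance_eq_sub (hmW j) hmU, hU0, mul_zero, sub_zero]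
    have : P[W j * U] = polyExpect hXG N (L * MvPolynomial.X j - C (e j / s) * (L * L)) := by
      rw [polyExpect_apply]
      refine integral_congr_ae (ae_of_all _ fun ω => ?_)
      simp [W, U, w]; ring
    rw [this, map_sub, polyExpect_C_mul, polyExpect_precisionForm_mul_X hXG hpd,
      polyExpect_precisionForm_mul_self hXG hpd, ← hs, div_mul_cancel₀ _ hs0.ne', he]
    simp [Matrix.one_apply, Pi.single_apply, eq_comm]
  have hind : IndepFun (fun ω j => W j ω) U P :=
    (hlaw.indepFun_of_covariance_eval (X := W) (Y := fun _ => U) hcov).comp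
      measurable_id (measurable_pi_apply ())
  have hvar : Var[U; P] = s := by
    rw [variance_eq_sub hmU, hU0, hs, ← polyExpect_precisionForm_mul_self hXG hpd, polyExpect_apply]
    simp [U, sq, hL]
  have hmapU : P.map U = gaussianReal 0 s.toNNReal := by
    have h : HasGaussianLaw U P := hlaw.snd.eval ()
    rw [h.map_eq_gaussianReal, hU0, hvar]
  have hsn : s.toNNReal ≠ 0 := by simpa using hs0
  have hsc : (s.toNNReal : ℝ) = s := Real.coe_toNNReal _ hs0.le
  have hWm : AEMeasurable (fun ω j => W j ω) P := hlaw.fst.aemeasurable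
  have hUm : AEMeasurable U P := hmU.1.aemeasurable
  set ν := P.map (fun ω j => W j ω) with hν
  have : IsProbabilityMeasure ν := Measure.isProbabilityMeasure_map hWm
  have hprod : P.map (fun ω => ((fun j => W j ω), U ω)) = ν.prod (gaussianReal 0 s.toNNReal) := by
    rw [(indepFun_iff_map_prod_eq_prod_map_map hWm hUm).1 hind, hmapU]
  let g : MvPolynomial (Fin N) ℝ → (Fin N → ℝ) × ℝ → ℝ := fun q z =>
    eval (z.1 + (z.2 / s) • e) q
  have hgc : ∀ q, Continuous (g q) := fun q => (MvPolynomial.continuous_eval q).comp (by fun_prop)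
  have hint : ∀ G : (Fin N → ℝ) × ℝ → ℝ, Continuous G →
      Integrable (fun ω => G ((fun j => W j ω), U ω)) P →
      Integrable G (ν.prod (gaussianReal 0 s.toNNReal)) ∧
      ∫ ω, G ((fun j => W j ω), U ω) ∂P =
        ∫ a, ∫ u, G (a, u) ∂gaussianReal 0 s.toNNReal ∂ν := by
    intro G hG hGi
    have h1 : Integrable G (ν.prod (gaussianReal 0 s.toNNReal)) := by
      rw [← hprod, integrable_map_measure hG.aestronglyMeasurable (hWm.prodMk hUm)]
      exact hGi
    refine ⟨h1, ?_⟩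
    rw [← integral_prod _ h1, ← hprod, integral_map (hWm.prodMk hUm) hG.aestronglyMeasurable]
  have hgX : ∀ q ω, g q ((fun j => W j ω), U ω) = eval (firstVars X N ω) q := fun q ω => by
    simp only [g, hXUW]
  obtain ⟨i1, e1⟩ := hint (fun z => z.2 * g p z) (continuous_snd.mul (hgc p)) (by
    simp only [hgX]
    exact (integrable_eval_firstVars hXG (L * p)).congr (ae_of_all _ fun ω => by simp [U]))
  obtain ⟨i2, -⟩ := hint (g p) (hgc p) (by
    simp only [hgX]; exact integrable_eval_firstVars hXG p)
  obtain ⟨i3, e3⟩ := hint (g (pderiv i p)) (hgc _) (by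
    simp only [hgX]; exact integrable_eval_firstVars hXG _)
  simp only [hgX] at e1 e3
  -- The chain-rule factor `1/s` cancels the variance `s` in the one-dimensional identity.
  have hderiv : ∀ a u, HasDerivAt (fun u => g p (a, u)) (g (pderiv i p) (a, u) / s) u := by
    intro a u
    have := (hasDerivAt_eval_line a i p (u / s)).scomp u ((hasDerivAt_id u).div_const s)
    convert! this using 1
    simp [g, he]; ring
  have hL' : polyExpect hXG N (L * p) = ∫ ω, U ω * eval (firstVars X N ω) p ∂P := by
    rw [polyExpect_apply]; simp [U]
  rw [hL', e1, polyExpect_apply, e3]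
  refine integral_congr_ae ?_
  filter_upwards [i1.prod_right_ae, i2.prod_right_ae, i3.prod_right_ae] with a h1 h2 h3
  rw [integral_mul_gaussianReal hsn (hderiv a) h2 h1 (h3.div_const s), hsc, integral_div]
  field_simp

end Stein

end Inputs

/-! ### Density of the polynomials -/

section Density

/-- The `σ`-algebra generated by the inputs. -/
abbrev inputSigma {Ω : Type*} (X : ℕ → Ω → ℝ) : MeasurableSpace Ω :=
  ⨆ i, MeasurableSpace.comap (X i) inferInstance

variable {Ω : Type*} [MeasurableSpace Ω] {P : Measure Ω} {X : ℕ → Ω → ℝ}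

/-- `exp(2|U|) ≤ exp(2U) + exp(-2U)`, and Gaussian exponential moments are finite. This supplies the
dominating function for termwise integration. -/
lemma memLp_exp_abs_of_hasGaussianLaw {U : Ω → ℝ} (hU : HasGaussianLaw U P) :
    MemLp (fun ω => Real.exp |U ω|) 2 P := by
  have hm : AEMeasurable U P := hU.aemeasurable
  have hexp : ∀ t : ℝ, Integrable (fun ω => Real.exp (t * U ω)) P := by
    intro t
    have := hU.map_eq_gaussianReal ▸ integrable_exp_mul_gaussianReal (μ := P[U])
      (v := Var[U; P].toNNReal) t
    exact this.comp_aemeasurable hm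
  have hmeas : AEStronglyMeasurable (fun ω => Real.exp |U ω|) P := by
    have : AEMeasurable (fun ω => Real.exp |U ω|) P := (Measurable.comp_aemeasurable
      (f := U) (g := fun x => Real.exp |x|) (by fun_prop) hm)
    exact this.aestronglyMeasurable
  rw [memLp_two_iff_integrable_sq hmeas]
  refine ((hexp 2).add (hexp (-2))).mono' (hmeas.pow 2) (ae_of_all _ fun ω => ?_)
  rw [Real.norm_of_nonneg (by positivity), ← Real.exp_nat_mul]
  simp only [Pi.add_apply]
  rcases abs_cases (U ω) with h | h <;> rw [h.1]
  · have := Real.exp_pos (-2 * U ω)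
    push_cast
    linarith
  · have := Real.exp_pos (2 * U ω)
    push_cast
    rw [mul_neg, ← neg_mul]
    linarith

/-- Termwise integration of the exponential series. The partial sums are dominated by `|Z| exp|U|`,
a product of two `L²` functions. -/
lemma integral_mul_cexp_eq_zero {U Z : Ω → ℝ} (hU : HasGaussianLaw U P) (hZ : MemLp Z 2 P)
    (h : ∀ n : ℕ, ∫ ω, Z ω * U ω ^ n ∂P = 0) :
    ∫ ω, (Z ω : ℂ) * Complex.exp (U ω * Complex.I) ∂P = 0 := by
  have hUm : AEMeasurable U P := hU.aemeasurable
  have hZm : AEMeasurable Z P := hZ.1.aemeasurable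
  have hsum : ∀ ω, HasSum (fun n : ℕ => |Z ω| * (|U ω| ^ n / n.factorial))
      (|Z ω| * Real.exp |U ω|) := fun ω => by
    have := NormedSpace.expSeries_div_hasSum_exp (𝔸 := ℝ) |U ω|
    rw [← Real.exp_eq_exp_ℝ] at this
    exact this.mul_left _
  have hs := hasSum_integral_of_dominated_convergence (μ := P)
    (F := fun (n : ℕ) ω => (Z ω : ℂ) * ((U ω * Complex.I) ^ n / n.factorial))
    (f := fun ω => (Z ω : ℂ) * Complex.exp (U ω * Complex.I))
    (fun n ω => |Z ω| * (|U ω| ^ n / n.factorial))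
    (fun n => by
      refine AEMeasurable.aestronglyMeasurable ?_
      fun_prop)
    (fun n => ae_of_all _ fun ω => by simp)
    (ae_of_all _ fun ω => (hsum ω).summable)
    (by
      simp only [fun ω => (hsum ω).tsum_eq]
      exact (memLp_exp_abs_of_hasGaussianLaw hU).integrable_mul hZ.abs |>.congr
        (ae_of_all _ fun ω => mul_comm _ _))
    (ae_of_all _ fun ω => by
      have := NormedSpace.expSeries_div_hasSum_exp (𝔸 := ℂ) (U ω * Complex.I)
      rw [← Complex.exp_eq_exp_ℂ] at this
      exact this.mul_left _)
  have h0 : ∀ n : ℕ,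
      ∫ ω, (Z ω : ℂ) * ((U ω * Complex.I) ^ n / n.factorial) ∂P = 0 := by
    intro n
    have : ∀ ω, (Z ω : ℂ) * ((U ω * Complex.I) ^ n / n.factorial) =
        (Complex.I ^ n / n.factorial) * ((Z ω * U ω ^ n : ℝ) : ℂ) := fun ω => by
      push_cast; ring
    simp only [this]
    rw [integral_const_mul, integral_complex_ofReal, h n]
    simp
  simp only [h0] at hs
  exact hs.unique hasSum_zero

lemma hasGaussianLaw_strongDual (hXG : IsGaussianProcess X P) {N : ℕ}
    (L : StrongDual ℝ (Fin N → ℝ)) : HasGaussianLaw (fun ω => L (firstVars X N ω)) P :=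
  (hasGaussianLaw_firstVars hXG N).map_fun L

lemma integral_mul_cexp_strongDual_eq_zero (hXG : IsGaussianProcess X P) {Z : Ω → ℝ}
    (hZ : MemLp Z 2 P) {N : ℕ}
    (h : ∀ q : MvPolynomial (Fin N) ℝ, ∫ ω, Z ω * eval (firstVars X N ω) q ∂P = 0)
    (L : StrongDual ℝ (Fin N → ℝ)) :
    ∫ ω, (Z ω : ℂ) * Complex.exp (L (firstVars X N ω) * Complex.I) ∂P = 0 := by
  refine integral_mul_cexp_eq_zero (hasGaussianLaw_strongDual hXG L) hZ fun n => ?_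
  have hL : ∀ x, L x = eval x
      (∑ i, MvPolynomial.X i * C (L fun j => if i = j then 1 else 0)) := fun x => by
    rw [← ContinuousLinearMap.coe_coe, LinearMap.pi_apply_eq_sum_univ L.toLinearMap x]
    simp
  rw [← h ((∑ i, MvPolynomial.X i * C (L fun j => if i = j then 1 else 0)) ^ n)]
  simp only [map_pow, ← hL]

/-- The two measures are `Z⁺P` and `Z⁻P`. The characteristic functions of their finite-dimensional
marginals differ by `E[Z exp(iL(X))] = 0`. -/
lemma map_withDensity_eq (hXm : ∀ i, Measurable (X i)) (hXG : IsGaussianProcess X P) {Z : Ω → ℝ}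
    (hZ : MemLp Z 2 P)
    (h : ∀ N (q : MvPolynomial (Fin N) ℝ), ∫ ω, Z ω * eval (firstVars X N ω) q ∂P = 0) :
    (P.withDensity fun ω => ENNReal.ofReal (Z ω)).map (fun ω i => X i ω) =
      (P.withDensity fun ω => ENNReal.ofReal (-Z ω)).map (fun ω i => X i ω) := by
  have := hXG.isProbabilityMeasure
  have hZi : Integrable Z P := hZ.integrable (by norm_num)
  have hZm : AEMeasurable Z P := hZ.1.aemeasurable
  have : IsFiniteMeasure (P.withDensity fun ω => ENNReal.ofReal (Z ω)) :=
    isFiniteMeasure_withDensity_ofReal hZi.2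
  have : IsFiniteMeasure (P.withDensity fun ω => ENNReal.ofReal (-Z ω)) :=
    isFiniteMeasure_withDensity_ofReal hZi.neg.2
  have hXall : Measurable fun ω i => X i ω := measurable_pi_lambda _ hXm
  have hfirst : ∀ N, Measurable (firstVars X N) := fun N => measurable_pi_lambda _ fun i => hXm i
  have hmarg : ∀ N, (P.withDensity fun ω => ENNReal.ofReal (Z ω)).map (firstVars X N) =
      (P.withDensity fun ω => ENNReal.ofReal (-Z ω)).map (firstVars X N) := by
    intro N
    refine Measure.ext_of_charFunDual (funext fun L => ?_)
    rw [charFunDual_apply, charFunDual_apply]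
    have hc : Continuous fun v : Fin N → ℝ => Complex.exp (L v * Complex.I) := by fun_prop
    rw [integral_map (hfirst N).aemeasurable hc.aestronglyMeasurable,
      integral_map (hfirst N).aemeasurable hc.aestronglyMeasurable,
      integral_withDensity_eq_integral_toReal_smul₀ (by fun_prop)
        (ae_of_all _ fun _ => ENNReal.ofReal_lt_top),
      integral_withDensity_eq_integral_toReal_smul₀ (by fun_prop)
        (ae_of_all _ fun _ => ENNReal.ofReal_lt_top), ← sub_eq_zero]
    have hbdd : ∀ f : Ω → ℝ, Integrable f P → Integrable (fun ω =>
        (ENNReal.ofReal (f ω)).toReal • Complex.exp (L (firstVars X N ω) * Complex.I)) P := by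
      intro f hf
      refine hf.mono ?_ (ae_of_all _ fun ω => ?_)
      · have h1 : AEMeasurable f P := hf.1.aemeasurable
        have h2 : AEMeasurable (fun ω => Complex.exp (L (firstVars X N ω) * Complex.I)) P :=
          (hc.measurable.comp (hfirst N)).aemeasurable
        exact AEMeasurable.aestronglyMeasurable (by fun_prop)
      · rw [norm_smul, Complex.norm_exp_ofReal_mul_I, mul_one, ENNReal.toReal_ofReal',
          Real.norm_eq_abs, Real.norm_eq_abs, abs_of_nonneg (le_max_right _ _)]
        exact max_le (le_abs_self _) (abs_nonneg _)
    rw [← integral_sub (hbdd _ hZi) (hbdd (fun ω => -Z ω) hZi.neg),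
      ← integral_mul_cexp_strongDual_eq_zero hXG hZ (h N) L]
    refine integral_congr_ae (ae_of_all _ fun ω => ?_)
    simp only [ENNReal.toReal_ofReal', Complex.real_smul, ← sub_mul, ← Complex.ofReal_sub,
      max_zero_sub_max_neg_zero_eq_self]
  -- Finite-dimensional marginals determine a finite measure on the sequence space, and every finite
  -- index set lies in an initial segment.
  refine IsProjectiveLimit.unique (P := fun I : Finset ℕ =>
    ((P.withDensity fun ω => ENNReal.ofReal (-Z ω)).map (fun ω i => X i ω)).map I.restrict)
    (fun I => ?_) (fun I => rfl)
  beta_reduce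
  obtain ⟨N, hN⟩ : ∃ N, ∀ i ∈ I, i < N :=
    ⟨I.sup id + 1, fun i hi => Nat.lt_succ_of_le (Finset.le_sup (f := id) hi)⟩
  let r : (Fin N → ℝ) → (I → ℝ) := fun v i => v ⟨i, hN i i.2⟩
  have hr : Measurable r := measurable_pi_lambda _ fun i => measurable_pi_apply _
  have hcomp : I.restrict ∘ (fun ω i => X i ω) = r ∘ firstVars X N := rfl
  rw [Measure.map_map (Finset.measurable_restrict I) hXall,
    Measure.map_map (Finset.measurable_restrict I) hXall, hcomp, ← Measure.map_map hr (hfirst N),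
    hmarg, Measure.map_map hr (hfirst N)]

/-- A square-integrable function of the inputs that is orthogonal to all polynomials vanishes. -/
theorem ae_eq_zero_of_integral_mul_polynomial_eq_zero (hXm : ∀ i, Measurable (X i))
    (hXG : IsGaussianProcess X P) {Z : Ω → ℝ} (hZ : MemLp Z 2 P)
    (hZm : AEStronglyMeasurable[inputSigma X] Z P)
    (h : ∀ N (q : MvPolynomial (Fin N) ℝ), ∫ ω, Z ω * eval (firstVars X N ω) q ∂P = 0) :
    Z =ᵐ[P] 0 := by
  have := hXG.isProbabilityMeasure
  have hZi : Integrable Z P := hZ.integrable (by norm_num)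
  have hle : inputSigma X ≤ ‹MeasurableSpace Ω› :=
    iSup_le fun i => (hXm i).comap_le
  have hXall : Measurable fun ω i => X i ω := measurable_pi_lambda _ hXm
  refine ae_eq_of_forall_setIntegral_eq_of_sigmaFinite' hle (fun s _ _ => hZi.integrableOn)
    (fun s _ _ => integrableOn_zero) (fun s hs _ => ?_) hZm aestronglyMeasurable_zero
  have hcomap : inputSigma X =
      MeasurableSpace.comap (fun ω i => X i ω) MeasurableSpace.pi := by
    simp only [MeasurableSpace.pi, MeasurableSpace.comap_iSup, MeasurableSpace.comap_comp]
    rfl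
  -- The set is the event that the input sequence lies in `B`; the integral of `Z` over it is the
  -- difference of the two equal image measures of `B`.
  obtain ⟨B, hB, rfl⟩ := hcomap ▸ hs
  have hs' := hle _ hs
  rw [integral_eq_lintegral_pos_part_sub_lintegral_neg_part hZi.restrict,
    ← withDensity_apply _ hs', ← withDensity_apply _ hs', ← Measure.map_apply hXall hB,
    ← Measure.map_apply hXall hB, map_withDensity_eq hXm hXG hZ h]
  simp

end Density

/-! ### Polynomial subspaces of `L²` -/

section Hilbert

variable {Ω : Type*} [MeasurableSpace Ω] {P : Measure Ω} {X : ℕ → Ω → ℝ}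
  (hXG : IsGaussianProcess X P)

/-- A polynomial in the first `N` inputs, as an element of `L²`. -/
noncomputable def polyLp (N : ℕ) : MvPolynomial (Fin N) ℝ →ₗ[ℝ] Lp ℝ 2 P where
  toFun q := (memLp_eval_firstVars hXG q 2 (by simp)).toLp
  map_add' q r := by
    rw [← MemLp.toLp_add]
    exact MemLp.toLp_congr _ _ (ae_of_all _ fun ω => by simp)
  map_smul' c q := by
    rw [RingHom.id_apply, ← MemLp.toLp_const_smul]
    exact MemLp.toLp_congr _ _ (ae_of_all _ fun ω => by simp [smul_eval])

lemma coeFn_polyLp {N : ℕ} (q : MvPolynomial (Fin N) ℝ) :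
    polyLp hXG N q =ᵐ[P] fun ω => eval (firstVars X N ω) q :=
  (memLp_eval_firstVars hXG q 2 (by simp)).coeFn_toLp

lemma inner_toLp_polyLp {Y : Ω → ℝ} (hY : MemLp Y 2 P) {N : ℕ} (q : MvPolynomial (Fin N) ℝ) :
    inner ℝ (hY.toLp Y) (polyLp hXG N q) = ∫ ω, Y ω * eval (firstVars X N ω) q ∂P := by
  rw [L2.inner_def]
  refine integral_congr_ae ?_
  filter_upwards [hY.coeFn_toLp, coeFn_polyLp hXG q] with ω h1 h2
  rw [h1, h2, real_inner_comm]
  rfl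

lemma inner_polyLp {N : ℕ} (q r : MvPolynomial (Fin N) ℝ) :
    inner ℝ (polyLp hXG N q) (polyLp hXG N r) = polyExpect hXG N (q * r) := by
  refine (inner_toLp_polyLp hXG (memLp_eval_firstVars hXG q 2 (by simp)) r).trans ?_
  simp [polyExpect_apply]

/-- Polynomials of total degree at most `m` in the first `N` inputs. -/
noncomputable def polySpace (N m : ℕ) : Submodule ℝ (Lp ℝ 2 P) :=
  (restrictTotalDegree (Fin N) ℝ m).map (polyLp hXG N)

lemma mem_polySpace {N m : ℕ} {f : Lp ℝ 2 P} :
    f ∈ polySpace hXG N m ↔ ∃ q : MvPolynomial (Fin N) ℝ, q.totalDegree ≤ m ∧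
      polyLp hXG N q = f := by
  simp [polySpace, mem_restrictTotalDegree]

lemma polySpace_mono {N N' m m' : ℕ} (hN : N ≤ N') (hm : m ≤ m') :
    polySpace hXG N m ≤ polySpace hXG N' m' := by
  intro f hf
  obtain ⟨q, hq, rfl⟩ := (mem_polySpace hXG).1 hf
  refine (mem_polySpace hXG).2 ⟨rename (Fin.castLE hN) q,
    (totalDegree_rename_le _ _).trans (hq.trans hm), ?_⟩
  refine MemLp.toLp_congr (memLp_eval_firstVars hXG _ 2 (by simp))
    (memLp_eval_firstVars hXG q 2 (by simp)) (ae_of_all _ fun ω => ?_)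
  exact eval_rename _ _ _

/-- The multi-indices of total degree at most `m`. -/
def multiIndices (N m : ℕ) : Finset (Fin N → ℕ) :=
  (Finset.range (m + 1)).biUnion fun l => Finset.piAntidiag Finset.univ l

lemma mem_multiIndices {N m : ℕ} {j : Fin N → ℕ} : j ∈ multiIndices N m ↔ ∑ i, j i ≤ m := by
  simp [multiIndices]

/-- Monomials of degree at most `m` span the polynomials of degree at most `m`. -/
lemma polySpace_le_span (N m : ℕ) :
    polySpace hXG N m ≤ Submodule.span ℝ (Set.range fun k : multiIndices N m =>
      polyLp hXG N (monomial (Finsupp.equivFunOnFinite.symm k.1) 1)) := by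
  intro f hf
  obtain ⟨q, hq, rfl⟩ := (mem_polySpace hXG).1 hf
  rw [q.as_sum, map_sum]
  refine Submodule.sum_mem _ fun v hv => ?_
  have : monomial v (coeff v q) = coeff v q • monomial v 1 := by simp [smul_monomial]
  rw [this, map_smul]
  refine Submodule.smul_mem _ _ (Submodule.subset_span ⟨⟨v, ?_⟩, ?_⟩)
  · rw [mem_multiIndices, ← Finsupp.degree_eq_sum]
    exact (le_totalDegree hv).trans hq
  · simp

instance (N m : ℕ) : FiniteDimensional ℝ (polySpace hXG N m) :=
  have : FiniteDimensional ℝ (Submodule.span ℝ (Set.range fun k : multiIndices N m =>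
      polyLp hXG N (monomial (Finsupp.equivFunOnFinite.symm k.1) 1))) :=
    FiniteDimensional.span_of_finite ℝ (Set.finite_range _)
  Submodule.finiteDimensional_of_le (polySpace_le_span hXG N m)

/-! ### The standardized Hermite polynomials -/

variable (P X) in
/-- The Hermite polynomial of the first `N` inputs, as a formal polynomial. -/
noncomputable def hermiteMv (N : ℕ) (j : Fin N → ℕ) : MvPolynomial (Fin N) ℝ :=
  hermiteAux (covMatrix P X N) j (List.finRange N)

lemma totalDegree_hermiteMv_le (N : ℕ) (j : Fin N → ℕ) :
    (hermiteMv P X N j).totalDegree ≤ ∑ i, j i := by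
  rw [Fin.sum_univ_def]
  exact totalDegree_hermiteAux_le _ _ _

variable (P X) in
/-- The standardized Hermite polynomial of the first `N` inputs, as a formal polynomial. -/
noncomputable def stdHermiteMv (N : ℕ) (j : Fin N → ℕ) : MvPolynomial (Fin N) ℝ :=
  C (√(∫ ω, hermitePoly (covMatrix P X N) j (firstVars X N ω) ^ 2 ∂P))⁻¹ * hermiteMv P X N j

lemma stdHermite_eq_eval {N : ℕ} (hpd : (covMatrix P X N).PosDef) (j : Fin N → ℕ) (ω : Ω) :
    stdHermite P X N j ω = eval (firstVars X N ω) (stdHermiteMv P X N j) := by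
  rw [stdHermite, hermitePoly_eq_eval hpd, stdHermiteMv, hermiteMv, map_mul, eval_C, div_eq_inv_mul]

lemma totalDegree_stdHermiteMv_le (N : ℕ) (j : Fin N → ℕ) :
    (stdHermiteMv P X N j).totalDegree ≤ ∑ i, j i := by
  refine (totalDegree_mul _ _).trans ?_
  simpa using totalDegree_hermiteMv_le N j

section Orthogonality

variable (hX0 : ∀ i, ∫ ω, X i ω ∂P = 0) {N : ℕ} (hpd : (covMatrix P X N).PosDef)
include hX0 hpd

lemma polyExpect_hermiteMv_mul_monomial (j k : Fin N → ℕ) (hk : ∑ i, k i ≤ ∑ i, j i) :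
    polyExpect hXG N (hermiteMv P X N j * monomial (Finsupp.equivFunOnFinite.symm k) 1) =
      if k = j then ∏ i, ((j i).factorial : ℝ) else 0 := by
  simpa using! apply_hermite_mul_monomial (E := polyExpect hXG N) (polyExpect_one hXG N)
    (polyExpect_precisionForm_mul hXG hX0 hpd) j (Finsupp.equivFunOnFinite.symm k) hk

lemma polyExpect_hermiteMv_mul_of_lt (j : Fin N → ℕ) (q : MvPolynomial (Fin N) ℝ)
    (hq : q.totalDegree < ∑ i, j i) : polyExpect hXG N (hermiteMv P X N j * q) = 0 := by
  rw [q.as_sum, Finset.mul_sum, map_sum]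
  refine Finset.sum_eq_zero fun v hv => ?_
  have h1 : monomial v (coeff v q) = coeff v q • monomial v 1 := by simp [smul_monomial]
  have h2 : ∑ i, v i < ∑ i, j i := by
    rw [← Finsupp.degree_eq_sum]
    exact (le_totalDegree hv).trans_lt hq
  have h3 := polyExpect_hermiteMv_mul_monomial hXG hX0 hpd j v h2.le
  rw [if_neg (by rintro rfl; exact lt_irrefl _ h2)] at h3
  rw [h1, mul_smul_comm, map_smul]
  simpa using Or.inr h3

/-- Pairing with monomials is triangular in the degree. Testing a relation against `x^k` kills every
other `j` with `|j| ≥ |k|`, and the coefficients of lower degree vanish by induction. -/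
lemma linearIndependent_hermiteMv :
    LinearIndependent ℝ fun j : Fin N → ℕ => polyLp hXG N (hermiteMv P X N j) := by
  rw [linearIndependent_iff']
  intro s g hg
  suffices h : ∀ (n : ℕ) (k : Fin N → ℕ), ∑ i, k i = n → k ∈ s → g k = 0 from
    fun k hk => h _ k rfl hk
  intro n
  induction n using Nat.strong_induction_on with
  | _ n ih =>
    intro k hkn hk
    have h1 := congrArg (fun f => inner ℝ f
      (polyLp hXG N (monomial (Finsupp.equivFunOnFinite.symm k) 1))) hg
    simp only [sum_inner, inner_smul_left, inner_polyLp, inner_zero_left] at h1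
    rw [Finset.sum_eq_single_of_mem k hk] at h1
    · rw [polyExpect_hermiteMv_mul_monomial hXG hX0 hpd k k le_rfl, if_pos rfl] at h1
      refine (mul_eq_zero.1 h1).resolve_right ?_
      exact Finset.prod_ne_zero_iff.2 fun i _ => by positivity
    · intro j hj hjk
      rcases lt_or_ge (∑ i, j i) n with hlt | hge
      · simp [ih _ hlt j rfl hj]
      · rw [polyExpect_hermiteMv_mul_monomial hXG hX0 hpd j k (hkn ▸ hge), if_neg hjk.symm,
          mul_zero]

/-- The Hermite polynomials of degree at most `m` span the polynomials of degree at most `m`. -/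
lemma span_hermiteMv (m : ℕ) :
    Submodule.span ℝ (Set.range fun j : multiIndices N m => polyLp hXG N (hermiteMv P X N j)) =
      polySpace hXG N m := by
  refine Submodule.eq_of_le_of_finrank_le ?_ ?_
  · rw [Submodule.span_le]
    rintro _ ⟨j, rfl⟩
    exact (mem_polySpace hXG).2 ⟨_, (totalDegree_hermiteMv_le N j.1).trans
      (mem_multiIndices.1 j.2), rfl⟩
  -- Dimension count: the independent Hermite family and the spanning monomials have the same finite
  -- index set.
  · have hcard := finrank_span_eq_card ((linearIndependent_hermiteMv hXG hX0 hpd).comp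
      (Subtype.val : multiIndices N m → _) Subtype.val_injective)
    refine le_of_le_of_eq ?_ hcard.symm
    have : FiniteDimensional ℝ (Submodule.span ℝ (Set.range fun k : multiIndices N m =>
      polyLp hXG N (monomial (Finsupp.equivFunOnFinite.symm k.1) 1))) :=
      FiniteDimensional.span_of_finite ℝ (Set.finite_range _)
    exact (Submodule.finrank_mono (polySpace_le_span hXG N m)).trans (finrank_range_le_card _)

-- An independent family contains no zero vector, so the normalization in `stdHermite` never divides
-- by zero.
include hXG in
lemma sqrt_integral_hermitePoly_ne_zero (j : Fin N → ℕ) :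
    √(∫ ω, hermitePoly (covMatrix P X N) j (firstVars X N ω) ^ 2 ∂P) ≠ 0 := by
  have h1 : ∫ ω, hermitePoly (covMatrix P X N) j (firstVars X N ω) ^ 2 ∂P =
      inner ℝ (polyLp hXG N (hermiteMv P X N j)) (polyLp hXG N (hermiteMv P X N j)) := by
    rw [inner_polyLp, polyExpect_apply]
    simp only [hermitePoly_eq_eval hpd, map_mul, sq, hermiteMv]
  rw [h1, ← norm_eq_sqrt_real_inner]
  exact norm_ne_zero_iff.2 ((linearIndependent_hermiteMv hXG hX0 hpd).ne_zero j)

lemma linearIndependent_stdHermiteMv :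
    LinearIndependent ℝ fun j : Fin N → ℕ => polyLp hXG N (stdHermiteMv P X N j) := by
  convert! (linearIndependent_hermiteMv hXG hX0 hpd).units_smul fun j =>
    (Units.mk0 _ (sqrt_integral_hermitePoly_ne_zero hXG hX0 hpd j))⁻¹ using 2 with j
  rw [stdHermiteMv, ← smul_eq_C_mul, map_smul]
  rfl

lemma inner_stdHermiteMv_of_ne (j k : Fin N → ℕ) (h : ∑ i, j i ≠ ∑ i, k i) :
    inner ℝ (polyLp hXG N (stdHermiteMv P X N j)) (polyLp hXG N (stdHermiteMv P X N k)) = 0 := by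
  wlog hlt : ∑ i, k i < ∑ i, j i generalizing j k
  · rw [real_inner_comm]
    exact this k j h.symm (lt_of_le_of_ne (not_lt.1 hlt) h)
  rw [inner_polyLp, stdHermiteMv, mul_assoc, polyExpect_C_mul,
    polyExpect_hermiteMv_mul_of_lt hXG hX0 hpd _ _ ((totalDegree_stdHermiteMv_le N k).trans_lt hlt),
    mul_zero]

lemma inner_eq_zero_of_mem_polySpace {m : ℕ} {f : Lp ℝ 2 P}
    (hf : ∀ k : Fin N → ℕ, ∑ i, k i ≤ m → inner ℝ f (polyLp hXG N (stdHermiteMv P X N k)) = 0)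
    {g : Lp ℝ 2 P} (hg : g ∈ polySpace hXG N m) : inner ℝ f g = 0 := by
  rw [← span_hermiteMv hXG hX0 hpd] at hg
  induction hg using Submodule.span_induction with
  | mem x hx =>
    obtain ⟨k, rfl⟩ := hx
    have := hf k (mem_multiIndices.1 k.2)
    rw [stdHermiteMv, ← smul_eq_C_mul, map_smul, inner_smul_right] at this
    exact (mul_eq_zero.1 this).resolve_left
      (inv_ne_zero (sqrt_integral_hermitePoly_ne_zero hXG hX0 hpd k))
  | zero => simp
  | add x y _ _ hx hy => rw [inner_add_right, hx, hy, add_zero]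
  | smul a x _ hx => rw [inner_smul_right, hx, mul_zero]

/-! ### Expansion coefficients and truncations -/

variable {Y : Ω → ℝ} (hY : MemLp Y 2 P)

omit hX0 in
lemma isCoeff_iff {C : (Fin N → ℕ) → ℝ} :
    IsCoeff P X Y N C ↔ ∀ j : Fin N → ℕ,
      ∑ k ∈ Finset.piAntidiag Finset.univ (∑ i, j i),
        C k * inner ℝ (polyLp hXG N (stdHermiteMv P X N j))
          (polyLp hXG N (stdHermiteMv P X N k)) =
      inner ℝ (hY.toLp Y) (polyLp hXG N (stdHermiteMv P X N j)) := by
  simp only [IsCoeff, inner_toLp_polyLp, inner_polyLp, polyExpect_apply, map_mul,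
    stdHermite_eq_eval hpd]

-- The equations decouple by degree. Each block is the Gram matrix of finitely many independent
-- vectors, hence positive definite and invertible.
include hXG hY in
theorem existsUnique_isCoeff : ∃! C : (Fin N → ℕ) → ℝ, IsCoeff P X Y N C := by
  set v : (Fin N → ℕ) → Lp ℝ 2 P := fun j => polyLp hXG N (stdHermiteMv P X N j) with hv
  have hli : LinearIndependent ℝ v := linearIndependent_stdHermiteMv hXG hX0 hpd
  have hex : ∀ l : ℕ, ∃ c : (Fin N → ℕ) → ℝ, ∀ j ∈ Finset.piAntidiag Finset.univ l,
      ∑ k ∈ Finset.piAntidiag Finset.univ l, c k * inner ℝ (v j) (v k) =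
        inner ℝ (hY.toLp Y) (v j) := by
    intro l
    let J := ↥(Finset.piAntidiag (Finset.univ : Finset (Fin N)) l)
    have hG : (Matrix.gram ℝ fun k : J => v k).PosDef :=
      Matrix.posDef_gram_of_linearIndependent (hli.comp _ Subtype.val_injective)
    have hdet : IsUnit (Matrix.gram ℝ fun k : J => v k).det := hG.det_pos.ne'.isUnit
    let b : J → ℝ := fun j => inner ℝ (hY.toLp Y) (v j)
    let c : J → ℝ := (Matrix.gram ℝ fun k : J => v k)⁻¹ *ᵥ b
    have hc : (Matrix.gram ℝ fun k : J => v k) *ᵥ c = b := by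
      rw [Matrix.mulVec_mulVec, Matrix.mul_nonsing_inv _ hdet, Matrix.one_mulVec]
    refine ⟨fun k => if h : k ∈ Finset.piAntidiag Finset.univ l then c ⟨k, h⟩ else 0,
      fun j hj => ?_⟩
    have := congrFun hc ⟨j, hj⟩
    rw [← Finset.sum_coe_sort]
    refine Eq.trans ?_ this
    refine Finset.sum_congr rfl fun k _ => ?_
    simp [Matrix.gram_apply, mul_comm]
  choose c hc using hex
  refine ⟨fun k => c (∑ i, k i) k, (isCoeff_iff hXG hpd hY).2 fun j => ?_, fun C' hC' => ?_⟩
  · rw [← hc (∑ i, j i) j (by simp)]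
    refine Finset.sum_congr rfl fun k hk => ?_
    rw [(Finset.mem_piAntidiag.1 hk).1]
  · replace hC' := (isCoeff_iff hXG hpd hY).1 hC'
    funext k₀
    set l := ∑ i, k₀ i with hl
    -- The difference of two solutions in degree `l` gives a vector orthogonal to every vector of
    -- its own block, hence to itself.
    have horth : ∀ j ∈ Finset.piAntidiag Finset.univ l,
        inner ℝ (v j) (∑ k ∈ Finset.piAntidiag Finset.univ l, (C' k - c l k) • v k) = 0 := by
      intro j hj
      have h1 := hC' j
      rw [(Finset.mem_piAntidiag.1 hj).1] at h1
      simp only [inner_sum, inner_smul_right, sub_mul, Finset.sum_sub_distrib]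
      rw [hc l j hj, ← h1, sub_self]
    have hzero : ∑ k ∈ Finset.piAntidiag Finset.univ l, (C' k - c l k) • v k = 0 := by
      rw [← inner_self_eq_zero (𝕜 := ℝ)]
      conv_lhs => rw [sum_inner]
      exact Finset.sum_eq_zero fun j hj => by rw [inner_smul_left, horth j hj, mul_zero]
    exact sub_eq_zero.1 (linearIndependent_iff'.1 hli _ _ hzero k₀ (by simp [hl]))

omit hX0 hpd in
variable (P X) in
/-- The truncated expansion, as a formal polynomial. -/
noncomputable def truncMv (N : ℕ) (C : (Fin N → ℕ) → ℝ) (m : ℕ) : MvPolynomial (Fin N) ℝ :=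
  ∑ l ∈ Finset.range (m + 1), ∑ j ∈ Finset.piAntidiag Finset.univ l, C j • stdHermiteMv P X N j

omit hX0 in
lemma truncPCE_ae_eq (C : (Fin N → ℕ) → ℝ) (m : ℕ) :
    truncPCE P X N C m =ᵐ[P] polyLp hXG N (truncMv P X N C m) := by
  refine EventuallyEq.trans (ae_of_all _ fun ω => ?_) (coeFn_polyLp hXG _).symm
  simp [truncPCE, truncMv, stdHermite_eq_eval hpd, smul_eval]

/-- The truncated expansion is an orthogonal projection. -/
theorem starProjection_polySpace {C : (Fin N → ℕ) → ℝ} (hC : IsCoeff P X Y N C) (m : ℕ) :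
    (polySpace hXG N m).starProjection (hY.toLp Y) = polyLp hXG N (truncMv P X N C m) := by
  refine Submodule.eq_starProjection_of_mem_of_inner_eq_zero ?_ fun w hw => ?_
  · refine (mem_polySpace hXG).2 ⟨_, ?_, rfl⟩
    refine totalDegree_finsetSum_le fun l hl => totalDegree_finsetSum_le fun j hj => ?_
    refine (totalDegree_smul_le _ _).trans ((totalDegree_stdHermiteMv_le N j).trans ?_)
    rw [(Finset.mem_piAntidiag.1 hj).1]
    exact Nat.lt_succ_iff.1 (Finset.mem_range.1 hl)
  -- Only the block of degree `|k|` pairs nontrivially with `Ψ_k`, and the coefficient equation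
  -- makes that pairing equal to the one with `y`.
  · refine inner_eq_zero_of_mem_polySpace hXG hX0 hpd (fun k hk => ?_) hw
    rw [inner_sub_left, sub_eq_zero, ← (isCoeff_iff hXG hpd hY).1 hC k, truncMv]
    simp only [map_sum, map_smul, sum_inner, inner_smul_left]
    rw [Finset.sum_eq_single_of_mem (∑ i, k i) (Finset.mem_range.2 (Nat.lt_succ_iff.2 hk))]
    · exact Finset.sum_congr rfl fun j _ => by rw [real_inner_comm]; rfl
    · intro l _ hlk
      refine Finset.sum_eq_zero fun j hj => ?_
      rw [inner_stdHermiteMv_of_ne hXG hX0 hpd j k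
        ((Finset.mem_piAntidiag.1 hj).1 ▸ hlk), mul_zero]

end Orthogonality

/-! ### Convergence -/

lemma convergesInAllModes_of_tendsto [IsProbabilityMeasure P] {ι : Type*} {l : Filter ι}
    [l.IsCountablyGenerated] {F : ι → Lp ℝ 2 P} {G : Lp ℝ 2 P} {Z : ι → Ω → ℝ} {Y : Ω → ℝ}
    (hZ : ∀ i, Z i =ᵐ[P] F i) (hY : Y =ᵐ[P] G) (h : Tendsto F l (𝓝 G)) :
    ConvergesInAllModes P Z l Y := by
  have hZm : ∀ i, AEStronglyMeasurable (Z i) P := fun i =>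
    (Lp.aestronglyMeasurable (F i)).congr (hZ i).symm
  have hYm : AEStronglyMeasurable Y P := (Lp.aestronglyMeasurable G).congr hY.symm
  have hms : Tendsto (fun i => eLpNorm (Z i - Y) 2 P) l (𝓝 0) := by
    refine ((Lp.tendsto_Lp_iff_tendsto_eLpNorm' F G).1 h).congr fun i => ?_
    exact eLpNorm_congr_ae ((hZ i).symm.sub hY.symm)
  have hprob := tendstoInMeasure_of_tendsto_eLpNorm (by simp) hZm hYm hms
  exact ⟨hms, hprob, hprob.tendstoInDistribution_of_aemeasurable
    (fun i => (hZm i).aemeasurable) hYm.aemeasurable⟩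

/-- A square-integrable function of the inputs is in the closure of the polynomials. -/
theorem toLp_mem_of_polySpace_le (hXm : ∀ i, Measurable (X i)) {Y : Ω → ℝ} (hY : MemLp Y 2 P)
    (hYm : AEStronglyMeasurable[inputSigma X] Y P)
    {K : Submodule ℝ (Lp ℝ 2 P)} (hK : IsClosed (K : Set (Lp ℝ 2 P)))
    (hle : ∀ N m, polySpace hXG N m ≤ K) : hY.toLp Y ∈ K := by
  have hm : inputSigma X ≤ ‹MeasurableSpace Ω› := iSup_le fun i => (hXm i).comap_le
  set V : Submodule ℝ (Lp ℝ 2 P) := (⨆ N, ⨆ m, polySpace hXG N m).topologicalClosure with hV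
  have hVK : V ≤ K := Submodule.topologicalClosure_minimal _ (iSup_le fun N => iSup_le (hle N)) hK
  have hsub : ∀ N m, polySpace hXG N m ≤ V := fun N m =>
    (le_iSup_of_le N (le_iSup (polySpace hXG N) m)).trans (Submodule.le_topologicalClosure _)
  -- Measurability with respect to the inputs survives `L²` limits, so the residual `Z` of the
  -- projection onto `V` stays a function of the inputs, as the density theorem requires.
  have hVmeas : V ≤ lpMeas ℝ ℝ (inputSigma X) 2 P := by
    refine Submodule.topologicalClosure_minimal _ (iSup_le fun N => iSup_le fun m f hf => ?_)
      (isClosed_aestronglyMeasurable hm)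
    obtain ⟨q, -, rfl⟩ := (mem_polySpace hXG).1 hf
    rw [mem_lpMeas_iff_aestronglyMeasurable]
    have hfirst : Measurable[inputSigma X] (firstVars X N) :=
      @measurable_pi_lambda _ _ _ (inputSigma X) _ _ fun i =>
        (comap_measurable (X i)).mono (le_iSup (fun i => MeasurableSpace.comap (X i) _) _) le_rfl
    exact ⟨fun ω => eval (firstVars X N ω) q, @Measurable.stronglyMeasurable _ _ _ (inputSigma X) _ _ _ _ _
      ((MvPolynomial.continuous_eval q).measurable.comp hfirst),
      coeFn_polyLp hXG q⟩
  have hYmem : hY.toLp Y ∈ lpMeas ℝ ℝ (inputSigma X) 2 P := by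
    rw [mem_lpMeas_iff_aestronglyMeasurable]
    exact hYm.congr hY.coeFn_toLp.symm
  set Z : Lp ℝ 2 P := hY.toLp Y - V.starProjection (hY.toLp Y) with hZ
  have hZmem : Z ∈ lpMeas ℝ ℝ (inputSigma X) 2 P :=
    Submodule.sub_mem _ hYmem (hVmeas (V.starProjection_apply_mem _))
  have hZ0 : Z = 0 := by
    rw [Lp.eq_zero_iff_ae_eq_zero]
    refine ae_eq_zero_of_integral_mul_polynomial_eq_zero hXm hXG (Lp.memLp Z)
      (mem_lpMeas_iff_aestronglyMeasurable.1 hZmem) fun N q => ?_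
    rw [← inner_toLp_polyLp hXG (Lp.memLp Z), Lp.toLp_coeFn]
    exact V.starProjection_inner_eq_zero _ _
      (hsub N _ ((mem_polySpace hXG).2 ⟨q, le_rfl, rfl⟩))
  rw [sub_eq_zero.1 hZ0]
  exact hVK (V.starProjection_apply_mem _)

end Hilbert

end GPCE

/-! ### The convergence theorem. -/

open GPCE

theorem proposition17 {Ω : Type*} [MeasurableSpace Ω] (P : Measure Ω) [IsProbabilityMeasure P]
    (X : ℕ → Ω → ℝ) (hXm : ∀ i, Measurable (X i))
    (hXG : IsGaussianProcess X P) (hX0 : ∀ i, ∫ ω, X i ω ∂P = 0)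
    (hXpd : ∀ N, (GPCE.covMatrix P X N).PosDef)
    (Y : Ω → ℝ) (hYL2 : MemLp Y 2 P)
    (hYm : AEStronglyMeasurable[⨆ i, MeasurableSpace.comap (X i) inferInstance] Y P) :
    (∀ N, ∃! C : (Fin N → ℕ) → ℝ, GPCE.IsCoeff P X Y N C) ∧
    ∀ C : (N : ℕ) → (Fin N → ℕ) → ℝ, (∀ N, GPCE.IsCoeff P X Y N (C N)) →
      GPCE.ConvergesInAllModes P
        (fun p : ℕ × ℕ => GPCE.truncPCE P X p.1 (C p.1) p.2) (atTop ×ˢ atTop) Y ∧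
      (∃ S : ℕ → Ω → ℝ, (∀ N, MemLp (S N) 2 P) ∧
        (∀ N, GPCE.ConvergesInAllModes P (fun m => GPCE.truncPCE P X N (C N) m) atTop (S N)) ∧
        GPCE.ConvergesInAllModes P S atTop Y) ∧
      (∃ T : ℕ → Ω → ℝ, (∀ m, MemLp (T m) 2 P) ∧
        (∀ m, GPCE.ConvergesInAllModes P (fun N => GPCE.truncPCE P X N (C N) m) atTop (T m)) ∧
        GPCE.ConvergesInAllModes P T atTop Y) := by
  refine ⟨fun N => existsUnique_isCoeff hXG hX0 (hXpd N) hYL2, fun C hC => ?_⟩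
  set y : Lp ℝ 2 P := hYL2.toLp Y with hy
  have hyY : Y =ᵐ[P] y := hYL2.coeFn_toLp.symm
  have htrunc : ∀ N m, truncPCE P X N (C N) m =ᵐ[P] (polySpace hXG N m).starProjection y :=
    fun N m => by
      rw [starProjection_polySpace hXG hX0 (hXpd N) hYL2 (hC N) m]
      exact truncPCE_ae_eq hXG (hXpd N) (C N) m
  -- Common source of the three limits to `y`: any monotone family of subspaces that eventually
  -- absorbs each polynomial space.
  have hlim : ∀ {ι : Type} [Preorder ι] (U : ι → Submodule ℝ (Lp ℝ 2 P))
      [∀ i, (U i).HasOrthogonalProjection], Monotone U →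
      (∀ N m, ∃ i, polySpace hXG N m ≤ U i) →
      Tendsto (fun i => (U i).starProjection y) atTop (𝓝 y) := by
    intro ι _ U _ hU hle
    have h1 := Submodule.starProjection_tendsto_closure_iSup U hU y
    have hmem : y ∈ (⨆ i, U i).topologicalClosure :=
      toLp_mem_of_polySpace_le hXG hXm hYL2 hYm (Submodule.isClosed_topologicalClosure _)
        fun N m => (hle N m).elim fun i hi =>
          hi.trans ((le_iSup U i).trans (Submodule.le_topologicalClosure _))
    rwa [Submodule.starProjection_eq_self_iff.2 hmem] at h1
  refine ⟨?_, ?_, ?_⟩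
  · rw [prod_atTop_atTop_eq]
    exact convergesInAllModes_of_tendsto (fun p => htrunc p.1 p.2) hyY
      (hlim (fun p : ℕ × ℕ => polySpace hXG p.1 p.2)
        (fun p q hpq => polySpace_mono hXG hpq.1 hpq.2) fun N m => ⟨(N, m), le_rfl⟩)
  -- `S_N` is the projection of `y` onto the closed span of all polynomials in the first `N` inputs.
  · let U : ℕ → Submodule ℝ (Lp ℝ 2 P) := fun N => (⨆ m, polySpace hXG N m).topologicalClosure
    refine ⟨fun N => (U N).starProjection y, fun N => Lp.memLp _, fun N => ?_, ?_⟩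
    · exact convergesInAllModes_of_tendsto (htrunc N) EventuallyEq.rfl
        (Submodule.starProjection_tendsto_closure_iSup (polySpace hXG N)
          (fun m m' h => polySpace_mono hXG le_rfl h) y)
    · refine convergesInAllModes_of_tendsto (fun _ => EventuallyEq.rfl) hyY (hlim U ?_ ?_)
      · exact fun N N' h => Submodule.topologicalClosure_mono
          (iSup_mono fun m => polySpace_mono hXG h le_rfl)
      · exact fun N m => ⟨N, (le_iSup (polySpace hXG N) m).trans
          (Submodule.le_topologicalClosure _)⟩
  -- `T_m` is the projection of `y` onto the closure of the polynomials of degree at most `m` in any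
  -- finite number of inputs.
  · let U : ℕ → Submodule ℝ (Lp ℝ 2 P) := fun m =>
      (⨆ N, polySpace hXG N m).topologicalClosure
    refine ⟨fun m => (U m).starProjection y, fun m => Lp.memLp _, fun m => ?_, ?_⟩
    · exact convergesInAllModes_of_tendsto (fun N => htrunc N m) EventuallyEq.rfl
        (Submodule.starProjection_tendsto_closure_iSup (fun N => polySpace hXG N m)
          (fun N N' h => polySpace_mono hXG h le_rfl) y)
    · refine convergesInAllModes_of_tendsto (fun _ => EventuallyEq.rfl) hyY (hlim U ?_ ?_)
      · exact fun m m' h => Submodule.topologicalClosure_mono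
          (iSup_mono fun N => polySpace_mono hXG le_rfl h)
      · exact fun N m => ⟨m, (le_iSup (fun N => polySpace hXG N m) N).trans
          (Submodule.le_topologicalClosure _)⟩
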